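/- **Theorem 2 (Strong normalization of $\lambda_{\parallel}$).** For every typed $\lambda_{\parallel}$ term $t$, every reduction of $t$ is finite, i.e. there is no infinite sequence $t=t_0\mapsto t_1\mapsto t_2\mapsto\cdots$. The calculus is as follows. *Types* are the formulas built from propositional atoms and $\bot$ with $\to$ and $\wedge$ ($\wedge$ associates to the right). *Threads* are the simply typed $\lambda$-terms, up to renaming of bound variables: intuitionistic variables $x^A$; output channels $\bar a^{T}$ and input channels $\underline a^{T}$, each of its own type $T$, for every channel name $a$ and formula $T$; $\lambda x^A u$, $t\,u$, $\langle u,t\rangle$, $u\,\pi_0$, $u\,\pi_1$, with the usual typing; and $\mathsf{efq}_P(u):P$ for $u:\bot$ and $P$ an atom other than $\bot$. Channels are not bound by $\lambda$. *Axiom schemata* are $\mathcal A=(\mathbb A_1\to\mathbb A_1\wedge\mathbb B_1)\vee\dots\vee(\mathbb A_m\to\mathbb A_m\wedge\mathbb B_m)$, $m\ge 1$, with distinct propositional variables $\mathbb A_i$, where each $\mathbb B_i$ is $\bot$ or $\mathbb A_{k_1}\wedge\dots\wedge\mathbb A_{k_p}$ with $p\ge1$, $k_1<\dots<k_p$. An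 instance is given by formulas $A_1,\dots,A_m$ for $\mathbb A_1,\dots,\mathbb A_m$; it determines $B_1,\dots,B_m$. *Typed $\lambda_{\parallel}$ terms* of type $B$ are (1) the simple parallel terms $t_1\parallel\dots\parallel t_n$, $n\ge1$, of threads $t_i:B$, and (2) the terms ${}_a^{\mathcal A}(v_1\parallel\dots\parallel v_m)$, where each process $v_i$ is a simple parallel term of type $B$ and, for some instance of $\mathcal A$, every occurrence of $\bar a$ or $\underline a$ in $v_i$ has type $A_i\to A_i\wedge B_i$. The process $v_i$ is *outlinked* to $v_j$ if $i\ne j$ and $\mathbb A_i$ is a conjunct of $\mathbb B_j$. *Reductions* $\mapsto$ are the following. - Intuitionistic: $(\lambda x^A u)\,t\mapsto u[t/x]$ and $\langle u_0,u_1\rangle\,\pi_i\mapsto u_i$, at any place in any thread. - Communication, in a term ${}_a^{\mathcal A}(v_1\parallel\dots\parallel v_m)$, with receiver $v_j$, where $\mathbb B_j=\mathbb A_{k_1}\wedge\dots\wedge\mathbb A_{k_p}$ is not $\bot$ and does not contain $\mathbb A_j$. Each outlinked process $v_{k_l}$ has the form $\mathcal C_l[\bar a\,w_l]$, where the displayed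 $\bar a$ is the rightmost occurrence of the channel $a$ in the process and all free variables of $w_l$ are free in the process; at least one thread of $v_j$ contains $a$, and every thread of $v_j$ that contains $a$ has the form $\mathcal D[\underline a\,v]$, where the displayed $\underline a$ is the rightmost occurrence of $a$ in the thread. The step replaces each $\mathcal C_l[\bar a\,w_l]$ by $\mathcal C_l[\underline a\,w_l]$ and each $\mathcal D[\underline a\,v]$ by $\mathcal D[\langle v,w_1,\dots,w_p\rangle]$ (without capturing variables of the $w_l$), and changes nothing else. - Simplification: ${}_a^{\mathcal A}(v_1\parallel\dots\parallel v_m)\mapsto u_{i_1}\parallel\dots\parallel u_{i_q}$, where $q\ge 1$, $u_1,\dots,u_r$ are all the threads of $v_1,\dots,v_m$ from left to right, $i_1<\dots<i_q$, and none of the $u_{i_1},\dots,u_{i_q}$ contains $a$. -/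

import Mathlib

namespace LamPar

/-- Types: formulas over `⊥` and countably many propositional atoms. -/
inductive Ty : Type
  | bot : Ty
  | atom : ℕ → Ty
  | arr : Ty → Ty → Ty
  | and : Ty → Ty → Ty

/-- Threads: terms of the simply typed `λ`-calculus, in Church style. Intuitionistic variables
are de Bruijn indices (so terms are taken up to `α`-equivalence); `send a T` and `get a T` are the
output and the input channel named `a`, of type `T`. The term `proj false u` is the first
projection `u π₀` and `proj true u` the second projection `u π₁`; `efq P u` has the atomic
type `P`. -/
inductive Tm : Type
  | var : ℕ → Tm
  | send : ℕ → Ty → Tm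
  | get : ℕ → Ty → Tm
  | lam : Ty → Tm → Tm
  | app : Tm → Tm → Tm
  | pair : Tm → Tm → Tm
  | proj : Bool → Tm → Tm
  | efq : ℕ → Tm → Tm

namespace Tm

/-- Extension of a renaming below a binder. -/
def upRen (ξ : ℕ → ℕ) : ℕ → ℕ
  | 0 => 0
  | n + 1 => ξ n + 1

/-- Renaming of the free variables. -/
def rename : (ℕ → ℕ) → Tm → Tm
  | ξ, var n => var (ξ n)
  | _, send a T => send a T
  | _, get a T => get a T
  | ξ, lam A u => lam A (rename (upRen ξ) u)
  | ξ, app t u => app (rename ξ t) (rename ξ u)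
  | ξ, pair t u => pair (rename ξ t) (rename ξ u)
  | ξ, proj b u => proj b (rename ξ u)
  | ξ, efq P u => efq P (rename ξ u)

/-- The same term, read below `d` further binders (none of which it mentions). -/
def lift (d : ℕ) (t : Tm) : Tm := rename (fun n => n + d) t

/-- Extension of a substitution below a binder. -/
def upSub (σ : ℕ → Tm) : ℕ → Tm
  | 0 => var 0
  | n + 1 => lift 1 (σ n)

/-- Capture-avoiding simultaneous substitution. -/
def subst : (ℕ → Tm) → Tm → Tm
  | σ, var n => σ n
  | _, send a T => send a T
  | _, get a T => get a T
  | σ, lam A u => lam A (subst (upSub σ) u)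
  | σ, app t u => app (subst σ t) (subst σ u)
  | σ, pair t u => pair (subst σ t) (subst σ u)
  | σ, proj b u => proj b (subst σ u)
  | σ, efq P u => efq P (subst σ u)

/-- `u[t/x]`, where `x` is the variable with index `0`. -/
def subst0 (u t : Tm) : Tm :=
  subst (fun n => match n with
    | 0 => t
    | k + 1 => var k) u

/-- The channel `a` occurs in the term, as an output or as an input channel. -/
def Occurs (a : ℕ) : Tm → Prop
  | var _ => False
  | send b _ => b = a
  | get b _ => b = a
  | lam _ u => Occurs a u
  | app t u => Occurs a t ∨ Occurs a u
  | pair t u => Occurs a t ∨ Occurs a u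
  | proj _ u => Occurs a u
  | efq _ u => Occurs a u

/-- All occurrences of the channel `a` in the term have type `T`. -/
def OccursOnlyAt (a : ℕ) (T : Ty) : Tm → Prop
  | var _ => True
  | send b S => b = a → S = T
  | get b S => b = a → S = T
  | lam _ u => OccursOnlyAt a T u
  | app t u => OccursOnlyAt a T t ∧ OccursOnlyAt a T u
  | pair t u => OccursOnlyAt a T t ∧ OccursOnlyAt a T u
  | proj _ u => OccursOnlyAt a T u
  | efq _ u => OccursOnlyAt a T u

/-- The tuple `⟨v, w₁, …, wₚ⟩`, associated to the right. -/
def tuple : Tm → List Tm → Tm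
  | v, [] => v
  | v, w :: ws => pair v (tuple w ws)

end Tm

/-- `HasType Γ t A`: the thread `t` has type `A`, its free intuitionistic variables being
declared in `Γ`. -/
inductive HasType : List Ty → Tm → Ty → Prop
  | var {Γ : List Ty} {n : ℕ} {A : Ty} : Γ[n]? = some A → HasType Γ (.var n) A
  | send {Γ : List Ty} (a : ℕ) (T : Ty) : HasType Γ (.send a T) T
  | get {Γ : List Ty} (a : ℕ) (T : Ty) : HasType Γ (.get a T) T
  | lam {Γ : List Ty} {A B : Ty} {u : Tm} :
      HasType (A :: Γ) u B → HasType Γ (.lam A u) (.arr A B)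
  | app {Γ : List Ty} {A B : Ty} {t u : Tm} :
      HasType Γ t (.arr A B) → HasType Γ u A → HasType Γ (.app t u) B
  | pair {Γ : List Ty} {A B : Ty} {t u : Tm} :
      HasType Γ t A → HasType Γ u B → HasType Γ (.pair t u) (.and A B)
  | fst {Γ : List Ty} {A B : Ty} {u : Tm} :
      HasType Γ u (.and A B) → HasType Γ (.proj false u) A
  | snd {Γ : List Ty} {A B : Ty} {u : Tm} :
      HasType Γ u (.and A B) → HasType Γ (.proj true u) B
  | efq {Γ : List Ty} (P : ℕ) {u : Tm} :
      HasType Γ u .bot → HasType Γ (.efq P u) (.atom P)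

/-- Simple contexts: threads with one hole. -/
inductive Ctx : Type
  | hole : Ctx
  | lam : Ty → Ctx → Ctx
  | appL : Ctx → Tm → Ctx
  | appR : Tm → Ctx → Ctx
  | pairL : Ctx → Tm → Ctx
  | pairR : Tm → Ctx → Ctx
  | proj : Bool → Ctx → Ctx
  | efq : ℕ → Ctx → Ctx

namespace Ctx

/-- Filling the hole, without renaming: the binders above the hole do bind. -/
def fill : Ctx → Tm → Tm
  | hole, s => s
  | lam A C, s => .lam A (fill C s)
  | appL C u, s => .app (fill C s) u
  | appR t C, s => .app t (fill C s)
  | pairL C u, s => .pair (fill C s) u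
  | pairR t C, s => .pair t (fill C s)
  | proj b C, s => .proj b (fill C s)
  | efq P C, s => .efq P (fill C s)

/-- The number of binders above the hole. -/
def depth : Ctx → ℕ
  | hole => 0
  | lam _ C => depth C + 1
  | appL C _ => depth C
  | appR _ C => depth C
  | pairL C _ => depth C
  | pairR _ C => depth C
  | proj _ C => depth C
  | efq _ C => depth C

/-- The channel `a` does not occur to the right of the hole. -/
def ClearRight (a : ℕ) : Ctx → Prop
  | hole => True
  | lam _ C => ClearRight a C
  | appL C u => ClearRight a C ∧ ¬ Tm.Occurs a u
  | appR _ C => ClearRight a C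
  | pairL C u => ClearRight a C ∧ ¬ Tm.Occurs a u
  | pairR _ C => ClearRight a C
  | proj _ C => ClearRight a C
  | efq _ C => ClearRight a C

end Ctx

/-- An axiom schema `(𝔸₁ → 𝔸₁ ∧ 𝔹₁) ∨ … ∨ (𝔸ₘ → 𝔸ₘ ∧ 𝔹ₘ)` with pairwise distinct propositional
variables `𝔸₁, …, 𝔸ₘ`. Here `links i` lists the indices `k₁ < … < kₚ` of
`𝔹ᵢ = 𝔸ₖ₁ ∧ … ∧ 𝔸ₖₚ`, and is empty when `𝔹ᵢ = ⊥`. -/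
structure Schema : Type where
  size : ℕ
  size_pos : 0 < size
  links : Fin size → List (Fin size)
  increasing : ∀ i, (links i).Pairwise (· < ·)

namespace Schema

/-- The conjunction of a list of formulas, associated to the right; `⊥` for the empty list. -/
def conj : List Ty → Ty
  | [] => .bot
  | [A] => A
  | A :: B :: l => .and A (conj (B :: l))

/-- The disjunct `Aᵢ → Aᵢ ∧ Bᵢ` of the instance of the schema given by the formulas `A`. -/
def chanTy (S : Schema) (A : Fin S.size → Ty) (i : Fin S.size) : Ty :=
  .arr (A i) (.and (A i) (conj ((S.links i).map A)))

/-- The `i`-th process is outlinked to the `j`-th process. -/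
def Outlinked (S : Schema) (i j : Fin S.size) : Prop := i ≠ j ∧ i ∈ S.links j

end Schema

/-- Terms of `λ∥`: a parallel composition of threads `t₁ ∥ … ∥ tₙ`, or processes in parallel
connected by a channel, where each process is a parallel composition of threads. -/
inductive PTm : Type
  | par : List Tm → PTm
  | chan (a : ℕ) (S : Schema) (u : Fin S.size → List Tm) : PTm

/-- Typing of `λ∥` terms. For one thread, `par` gives the simply typed terms themselves. -/
inductive PHasType : List Ty → PTm → Ty → Prop
  | par {Γ : List Ty} {l : List Tm} {B : Ty} :
      l ≠ [] → (∀ t ∈ l, HasType Γ t B) → PHasType Γ (.par l) B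
  | chan {Γ : List Ty} {a : ℕ} {S : Schema} {u : Fin S.size → List Tm} {B : Ty}
      (A : Fin S.size → Ty) :
      (∀ i, u i ≠ []) →
      (∀ i, ∀ t ∈ u i, HasType Γ t B ∧ Tm.OccursOnlyAt a (S.chanTy A i) t) →
      PHasType Γ (.chan a S u) B

/-- The contraction of an intuitionistic redex. -/
inductive Contr : Tm → Tm → Prop
  | beta (A : Ty) (u t : Tm) : Contr (.app (.lam A u) t) (u.subst0 t)
  | fst (u v : Tm) : Contr (.proj false (.pair u v)) u
  | snd (u v : Tm) : Contr (.proj true (.pair u v)) v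

/-- One intuitionistic reduction step in a thread. -/
inductive TStep : Tm → Tm → Prop
  | ctx (C : Ctx) {s s' : Tm} : Contr s s' → TStep (C.fill s) (C.fill s')

/-- One intuitionistic reduction step in one thread of a parallel composition. -/
inductive LStep : List Tm → List Tm → Prop
  | mk (l r : List Tm) {t t' : Tm} : TStep t t' → LStep (l ++ t :: r) (l ++ t' :: r)

/-- `Sends a l w l'`: the rightmost occurrence of `a` in the process `l` is in an application
`send a w`, and `l'` is the process with that application replaced by `get a w`. The message `w` is
given outside of the context; that its occurrence in the process is a lifting expresses that the
free variables of the message are free in the process. -/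
inductive Sends (a : ℕ) : List Tm → Tm → List Tm → Prop
  | mk (l r : List Tm) (C : Ctx) (T : Ty) (w : Tm) :
      (∀ t ∈ r, ¬ Tm.Occurs a t) → C.ClearRight a → ¬ Tm.Occurs a w →
      Sends a (l ++ C.fill (.app (.send a T) (w.lift C.depth)) :: r) w
        (l ++ C.fill (.app (.get a T) (w.lift C.depth)) :: r)

/-- `Receives a ws t t'`: either the thread `t` does not contain `a` and is unchanged, or its
rightmost occurrence of `a` is in an application `get a v`, which is replaced by the tuple
`⟨v, w₁, …, wₚ⟩` (without capture of the variables of the messages). -/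
inductive Receives (a : ℕ) (ws : List Tm) : Tm → Tm → Prop
  | idle (t : Tm) : ¬ Tm.Occurs a t → Receives a ws t t
  | recv (D : Ctx) (T : Ty) (v : Tm) :
      D.ClearRight a → ¬ Tm.Occurs a v →
      Receives a ws (D.fill (.app (.get a T) v))
        (D.fill (Tm.tuple v (ws.map (Tm.lift D.depth))))

/-- The communication with receiver `j`: all processes outlinked to the `j`-th one send a message,
all threads of the `j`-th process that contain the channel (there is at least one) receive the
messages, and the other processes do not change. The conditions on `S.links j` say that the tuple
received has the type `Aⱼ ∧ Bⱼ` of the application that it replaces. -/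
inductive Comm (a : ℕ) (S : Schema) (u u' : Fin S.size → List Tm) : Prop
  | mk (j : Fin S.size) (w : Fin S.size → Tm) :
      S.links j ≠ [] → j ∉ S.links j →
      (∃ t ∈ u j, Tm.Occurs a t) →
      (∀ i, S.Outlinked i j → Sends a (u i) (w i) (u' i)) →
      List.Forall₂ (Receives a ((S.links j).map w)) (u j) (u' j) →
      (∀ i, ¬ S.Outlinked i j → i ≠ j → u' i = u i) →
      Comm a S u u'

/-- All threads of a family of processes, from left to right. -/
def allThreads {m : ℕ} (u : Fin m → List Tm) : List Tm := (List.ofFn u).flatten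

/-- One-step reduction of `λ∥` terms. -/
inductive Step : PTm → PTm → Prop
  | par {l l' : List Tm} : LStep l l' → Step (.par l) (.par l')
  | thread {a : ℕ} {S : Schema} {u : Fin S.size → List Tm} (i : Fin S.size) {l : List Tm} :
      LStep (u i) l → Step (.chan a S u) (.chan a S (Function.update u i l))
  | comm {a : ℕ} {S : Schema} {u u' : Fin S.size → List Tm} :
      Comm a S u u' → Step (.chan a S u) (.chan a S u')
  | simplify {a : ℕ} {S : Schema} {u : Fin S.size → List Tm} {l : List Tm} :
      l ≠ [] → l.Sublist (allThreads u) → (∀ t ∈ l, ¬ Tm.Occurs a t) →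
      Step (.chan a S u) (.par l)

/-- Strong normalizability: there is no infinite reduction of `t`. -/
def SN (t : PTm) : Prop :=
  ¬ ∃ f : ℕ → PTm, f 0 = t ∧ ∀ n, Step (f n) (f (n + 1))

end LamPar

/-!
In a term `ₐ(v₁ ∥ … ∥ vₘ)` a message never contains the channel `a`, because the displayed
occurrence of `a` in the sending process is the rightmost one. This breaks the apparent circularity
between the processes: for each process separately, a communication can be read as a local step of
its threads. A sending thread turns an output channel into the input channel of the same type, and
a receiving thread replaces `get a v` by `⟨v, w₁, …, wₚ⟩`, where the `wᵢ` are *arbitrary* typed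
threads without `a`. This is the relation `Red M`, with `M` the admissible messages.

Strong normalization for `Red M` is proved by Tait's method (`HasType.reducible`). Threads without
`a` are reducible as in the simply typed `λ`-calculus. Hence all messages are reducible, hence so is
the input channel `a` (`reducible_get_msgs`), hence so is the output channel `a`, whose only reduct
is the input channel, and hence so are all typed threads. For the closure of `Red M` under
substitution the messages must be closed, so the variables of the context are first replaced by
channels other than `a`, which behave like constants (`closing`).

A step of the parallel term is zero or one `Red M` step in each thread, and at least one such step
in some thread. So the formal sum of the ordinal ranks of all threads decreases along intuitionistic
steps and communications (`ProcTyped.comm`). A simplification leads to threads in parallel, for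
which the same measure, without messages, decreases.
-/

namespace LamPar

namespace Tm

/-! ### Substitution -/

/-- The substitution mapping the index `0` to `t` and `n + 1` to `σ n`. -/
def scons (t : Tm) (σ : ℕ → Tm) : ℕ → Tm
  | 0 => t
  | n + 1 => σ n

theorem subst0_eq (u t : Tm) : subst0 u t = subst (scons t var) u := by
  unfold subst0
  congr 1

theorem rename_rename (t : Tm) (ξ ζ : ℕ → ℕ) :
    rename ξ (rename ζ t) = rename (fun n => ξ (ζ n)) t := by
  induction t generalizing ξ ζ with
  | lam A u ih =>
    have h : (fun n => upRen ξ (upRen ζ n)) = upRen (fun n => ξ (ζ n)) := by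
      funext n; cases n <;> rfl
    simp only [rename, ih, h]
  | _ => simp_all [rename]

theorem subst_rename (t : Tm) (σ : ℕ → Tm) (ξ : ℕ → ℕ) :
    subst σ (rename ξ t) = subst (fun n => σ (ξ n)) t := by
  induction t generalizing σ ξ with
  | lam A u ih =>
    have h : (fun n => upSub σ (upRen ξ n)) = upSub (fun n => σ (ξ n)) := by
      funext n; cases n <;> rfl
    simp only [rename, subst, ih, h]
  | _ => simp_all [rename, subst]

theorem rename_subst (t : Tm) (ξ : ℕ → ℕ) (σ : ℕ → Tm) :
    rename ξ (subst σ t) = subst (fun n => rename ξ (σ n)) t := by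
  induction t generalizing ξ σ with
  | lam A u ih =>
    have h : (fun n => rename (upRen ξ) (upSub σ n)) = upSub (fun n => rename ξ (σ n)) := by
      funext n
      cases n with
      | zero => rfl
      | succ n => simp only [upSub, lift, rename_rename]; rfl
    simp only [rename, subst, ih, h]
  | _ => simp_all [rename, subst]

theorem subst_subst (t : Tm) (τ σ : ℕ → Tm) :
    subst τ (subst σ t) = subst (fun n => subst τ (σ n)) t := by
  induction t generalizing τ σ with
  | lam A u ih =>
    have h : (fun n => subst (upSub τ) (upSub σ n)) = upSub (fun n => subst τ (σ n)) := by
      funext n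
      cases n with
      | zero => rfl
      | succ n => simp only [upSub, lift, subst_rename, rename_subst]
    simp only [subst, ih, h]
  | _ => simp_all [subst]

theorem upSub_var : upSub var = var := by
  funext n; cases n <;> rfl

theorem subst_var (t : Tm) : subst var t = t := by
  induction t with
  | lam A u ih => simp only [subst, upSub_var, ih]
  | _ => simp_all [subst]

theorem subst0_subst_upSub (u v : Tm) (σ : ℕ → Tm) :
    subst0 (subst (upSub σ) u) v = subst (scons v σ) u := by
  rw [subst0_eq, subst_subst]
  congr 1
  funext n
  cases n with
  | zero => rfl
  | succ n =>
    simp only [upSub, lift, subst_rename, scons]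
    exact subst_var _

theorem subst_subst0 (u t : Tm) (σ : ℕ → Tm) :
    subst σ (subst0 u t) = subst0 (subst (upSub σ) u) (subst σ t) := by
  rw [subst0_subst_upSub, subst0_eq, subst_subst]
  congr 1
  funext n
  cases n <;> rfl

theorem subst_tuple (σ : ℕ → Tm) (v : Tm) (ws : List Tm) :
    subst σ (tuple v ws) = tuple (subst σ v) (ws.map (subst σ)) := by
  induction ws generalizing v with
  | nil => rfl
  | cons w ws ih => simp only [tuple, subst, List.map_cons, ih]

theorem subst_iterate_upSub_lift (d : ℕ) (σ : ℕ → Tm) (w : Tm) :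
    subst (upSub^[d] σ) (lift d w) = lift d (subst σ w) := by
  have h : ∀ n, (upSub^[d] σ) (n + d) = lift d (σ n) := by
    induction d with
    | zero =>
      intro n
      have : ∀ t, lift 0 t = t := fun t => by
        have := subst_rename t var id
        rw [subst_var] at this
        exact this.trans (subst_var t)
      simp [this]
    | succ d ih =>
      intro n
      rw [Function.iterate_succ_apply', ← Nat.add_assoc]
      simp only [upSub, ih, lift, rename_rename, Nat.add_assoc]
  simp only [lift, subst_rename, rename_subst]
  congr 1
  funext n
  exact h n

/-! ### Channels occurring in a thread -/

/-- All channels occurring in the thread, with their names and types, satisfy `P`. -/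
def AllChan (P : ℕ → Ty → Prop) : Tm → Prop
  | var _ => True
  | send b S => P b S
  | get b S => P b S
  | lam _ u => AllChan P u
  | app t u => AllChan P t ∧ AllChan P u
  | pair t u => AllChan P t ∧ AllChan P u
  | proj _ u => AllChan P u
  | efq _ u => AllChan P u

theorem occursOnlyAt_iff (a : ℕ) (T : Ty) (t : Tm) :
    OccursOnlyAt a T t ↔ AllChan (fun b S => b = a → S = T) t := by
  induction t <;> simp_all [OccursOnlyAt, AllChan]

theorem not_occurs_iff (a : ℕ) (t : Tm) : ¬ Occurs a t ↔ AllChan (fun b _ => b ≠ a) t := by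
  induction t <;> simp_all [Occurs, AllChan]

theorem AllChan.mono {P Q : ℕ → Ty → Prop} (h : ∀ b S, P b S → Q b S) {t : Tm}
    (ht : AllChan P t) : AllChan Q t := by
  induction t <;> simp_all [AllChan]

theorem allChan_rename {P : ℕ → Ty → Prop} (ξ : ℕ → ℕ) (t : Tm) :
    AllChan P (rename ξ t) ↔ AllChan P t := by
  induction t generalizing ξ <;> simp_all [AllChan, rename]

theorem AllChan.subst {P : ℕ → Ty → Prop} {σ : ℕ → Tm} (hσ : ∀ n, AllChan P (σ n)) {t : Tm}
    (ht : AllChan P t) : AllChan P (subst σ t) := by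
  induction t generalizing σ with
  | var n => exact hσ n
  | lam A u ih =>
    refine ih (σ := upSub σ) ?_ ht
    rintro (_ | n)
    · trivial
    · exact (allChan_rename _ _).2 (hσ n)
  | _ => simp_all [AllChan, Tm.subst]

theorem allChan_tuple {P : ℕ → Ty → Prop} {v : Tm} {ws : List Tm} (hv : AllChan P v)
    (hws : ∀ w ∈ ws, AllChan P w) : AllChan P (tuple v ws) := by
  induction ws generalizing v with
  | nil => exact hv
  | cons w ws ih =>
    exact ⟨hv, ih (hws w (by simp)) fun x hx => hws x (by simp [hx])⟩

end Tm

theorem Ctx.allChan_fill {P : ℕ → Ty → Prop} (C : Ctx) {s : Tm}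
    (h : Tm.AllChan P (C.fill s)) :
    Tm.AllChan P s ∧ ∀ s', Tm.AllChan P s' → Tm.AllChan P (C.fill s') := by
  induction C with
  | hole => exact ⟨h, fun _ h => h⟩
  | _ => simp_all [Ctx.fill, Tm.AllChan]

/-! ### Typing -/

namespace HasType

theorem rename {Γ Δ : List Ty} {t : Tm} {A : Ty} {ξ : ℕ → ℕ} (ht : HasType Γ t A)
    (hξ : ∀ n B, Γ[n]? = some B → Δ[ξ n]? = some B) : HasType Δ (Tm.rename ξ t) A := by
  induction ht generalizing Δ ξ with
  | var h => exact .var (hξ _ _ h)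
  | send a T => exact .send a T
  | get a T => exact .get a T
  | lam _ ih =>
    refine .lam (ih ?_)
    rintro (_ | n) B hB
    · exact hB
    · exact hξ n B hB
  | app _ _ ih₁ ih₂ => exact .app (ih₁ hξ) (ih₂ hξ)
  | pair _ _ ih₁ ih₂ => exact .pair (ih₁ hξ) (ih₂ hξ)
  | fst _ ih => exact .fst (ih hξ)
  | snd _ ih => exact .snd (ih hξ)
  | efq P _ ih => exact .efq P (ih hξ)

theorem of_rename {Γ Δ : List Ty} {t : Tm} {A : Ty} {ξ : ℕ → ℕ}
    (ht : HasType Δ (Tm.rename ξ t) A)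
    (hξ : ∀ n B, Δ[ξ n]? = some B → Γ[n]? = some B) : HasType Γ t A := by
  induction t generalizing Γ Δ ξ A with
  | var n => cases ht with | var h => exact .var (hξ _ _ h)
  | send a T => cases ht; exact .send a T
  | get a T => cases ht; exact .get a T
  | lam B u ih =>
    cases ht with
    | lam h =>
      refine .lam (ih h ?_)
      rintro (_ | n) B hB
      · exact hB
      · exact hξ n B hB
  | app t u ih₁ ih₂ => cases ht with | app h₁ h₂ => exact .app (ih₁ h₁ hξ) (ih₂ h₂ hξ)
  | pair t u ih₁ ih₂ => cases ht with | pair h₁ h₂ => exact .pair (ih₁ h₁ hξ) (ih₂ h₂ hξ)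
  | proj b u ih =>
    cases ht with
    | fst h => exact .fst (ih h hξ)
    | snd h => exact .snd (ih h hξ)
  | efq P u ih => cases ht with | efq _ h => exact .efq P (ih h hξ)

theorem subst {Γ Δ : List Ty} {t : Tm} {A : Ty} {σ : ℕ → Tm} (ht : HasType Γ t A)
    (hσ : ∀ n B, Γ[n]? = some B → HasType Δ (σ n) B) : HasType Δ (Tm.subst σ t) A := by
  induction ht generalizing Δ σ with
  | var h => exact hσ _ _ h
  | send a T => exact .send a T
  | get a T => exact .get a T
  | lam _ ih =>
    refine .lam (ih ?_)
    rintro (_ | n) B hB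
    · exact .var hB
    · exact (hσ n B hB).rename fun _ _ h => h
  | app _ _ ih₁ ih₂ => exact .app (ih₁ hσ) (ih₂ hσ)
  | pair _ _ ih₁ ih₂ => exact .pair (ih₁ hσ) (ih₂ hσ)
  | fst _ ih => exact .fst (ih hσ)
  | snd _ ih => exact .snd (ih hσ)
  | efq P _ ih => exact .efq P (ih hσ)

theorem subst_eq_self {Γ : List Ty} {t : Tm} {A : Ty} {σ : ℕ → Tm} (ht : HasType Γ t A)
    (hσ : ∀ n < Γ.length, σ n = .var n) : Tm.subst σ t = t := by
  induction ht generalizing σ with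
  | var h => exact hσ _ (List.getElem?_eq_some_iff.1 h).1
  | lam _ ih =>
    have := ih (σ := Tm.upSub σ) (by
      rintro (_ | n) hn
      · rfl
      · simp only [Tm.upSub, hσ n (by simpa using hn)]; rfl)
    simp only [Tm.subst, this]
  | _ => simp_all [Tm.subst]

theorem subst_of_closed {t : Tm} {A : Ty} (ht : HasType [] t A) (σ : ℕ → Tm) :
    Tm.subst σ t = t :=
  ht.subst_eq_self fun n hn => absurd hn (Nat.not_lt_zero n)

theorem lift_of_closed {t : Tm} {A : Ty} (ht : HasType [] t A) (d : ℕ) : Tm.lift d t = t := by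
  have h := Tm.subst_rename t Tm.var (fun n => n + d)
  rw [Tm.subst_var, ht.subst_of_closed] at h
  exact h

theorem lift_iff {Γ Δ : List Ty} {t : Tm} {A : Ty} :
    HasType (Δ ++ Γ) (Tm.lift Δ.length t) A ↔ HasType Γ t A := by
  have h : ∀ n : ℕ, (Δ ++ Γ)[n + Δ.length]? = Γ[n]? := fun n => by
    rw [List.getElem?_append_right (by omega), Nat.add_sub_cancel]
  exact ⟨fun ht => ht.of_rename fun n B hB => h n ▸ hB,
    fun ht => ht.rename fun n B hB => (h n).trans hB⟩

theorem tuple {Γ : List Ty} {v : Tm} {X : Ty} {ws : List Tm} {Ys : List Ty}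
    (hv : HasType Γ v X) (hws : List.Forall₂ (HasType Γ) ws Ys) (hne : Ys ≠ []) :
    HasType Γ (Tm.tuple v ws) (.and X (Schema.conj Ys)) := by
  induction hws generalizing v X with
  | nil => exact absurd rfl hne
  | @cons w Y ws Ys hw hws ih =>
    refine .pair hv ?_
    cases Ys with
    | nil => cases hws; exact hw
    | cons Z Ys => exact ih hw (by simp)

/-- Decomposition of a typing derivation at the hole of a context; `Δ` declares the variables
bound above the hole. -/
theorem fill {Γ : List Ty} {C : Ctx} {s : Tm} {B : Ty} (h : HasType Γ (C.fill s) B) :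
    ∃ Δ X, Δ.length = C.depth ∧ HasType (Δ ++ Γ) s X ∧
      ∀ s', HasType (Δ ++ Γ) s' X → HasType Γ (C.fill s') B := by
  induction C generalizing Γ B with
  | hole => exact ⟨[], B, rfl, h, fun _ h => h⟩
  | lam A C ih =>
    cases h with
    | lam h =>
      obtain ⟨Δ, X, hd, hs, hf⟩ := ih h
      refine ⟨Δ ++ [A], X, by simp [Ctx.depth, hd], by simpa using hs, fun s' h' => ?_⟩
      exact .lam (hf s' (by simpa using h'))
  | appL C u ih =>
    cases h with
    | app h₁ h₂ =>
      obtain ⟨Δ, X, hd, hs, hf⟩ := ih h₁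
      exact ⟨Δ, X, hd, hs, fun s' h' => .app (hf s' h') h₂⟩
  | appR t C ih =>
    cases h with
    | app h₁ h₂ =>
      obtain ⟨Δ, X, hd, hs, hf⟩ := ih h₂
      exact ⟨Δ, X, hd, hs, fun s' h' => .app h₁ (hf s' h')⟩
  | pairL C u ih =>
    cases h with
    | pair h₁ h₂ =>
      obtain ⟨Δ, X, hd, hs, hf⟩ := ih h₁
      exact ⟨Δ, X, hd, hs, fun s' h' => .pair (hf s' h') h₂⟩
  | pairR t C ih =>
    cases h with
    | pair h₁ h₂ =>
      obtain ⟨Δ, X, hd, hs, hf⟩ := ih h₂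
      exact ⟨Δ, X, hd, hs, fun s' h' => .pair h₁ (hf s' h')⟩
  | proj b C ih =>
    cases h with
    | fst h =>
      obtain ⟨Δ, X, hd, hs, hf⟩ := ih h
      exact ⟨Δ, X, hd, hs, fun s' h' => .fst (hf s' h')⟩
    | snd h =>
      obtain ⟨Δ, X, hd, hs, hf⟩ := ih h
      exact ⟨Δ, X, hd, hs, fun s' h' => .snd (hf s' h')⟩
  | efq P C ih =>
    cases h with
    | efq _ h =>
      obtain ⟨Δ, X, hd, hs, hf⟩ := ih h
      exact ⟨Δ, X, hd, hs, fun s' h' => .efq P (hf s' h')⟩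

theorem contr {Γ : List Ty} {s s' : Tm} {A : Ty} (h : HasType Γ s A) (hs : Contr s s') :
    HasType Γ s' A := by
  cases hs with
  | beta A u t =>
    cases h with
    | app h₁ h₂ =>
      cases h₁ with
      | lam h₁ =>
        rw [Tm.subst0_eq]
        refine h₁.subst ?_
        rintro (_ | n) B hB
        · cases hB; exact h₂
        · exact .var hB
  | fst u v =>
    cases h with | fst h => cases h with | pair h₁ h₂ => exact h₁
  | snd u v =>
    cases h with | snd h => cases h with | pair h₁ h₂ => exact h₂

/-- Subject reduction for intuitionistic steps. -/
theorem tstep {Γ : List Ty} {t t' : Tm} {A : Ty} (h : HasType Γ t A) (ht : TStep t t') :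
    HasType Γ t' A := by
  cases ht with
  | ctx C hs =>
    obtain ⟨Δ, X, -, h₁, h₂⟩ := h.fill
    exact h₂ _ (h₁.contr hs)

end HasType

theorem Tm.AllChan.tstep {P : ℕ → Ty → Prop} {t t' : Tm} (h : AllChan P t) (ht : TStep t t') :
    AllChan P t' := by
  cases ht with
  | ctx C hs =>
    obtain ⟨h₁, h₂⟩ := C.allChan_fill h
    refine h₂ _ ?_
    cases hs with
    | beta A u t =>
      rw [subst0_eq]
      refine AllChan.subst ?_ h₁.1
      rintro (_ | n)
      · exact h₁.2
      · trivial
    | fst _ _ => exact h₁.1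
    | snd _ _ => exact h₁.2

/-! ### Threads with a local account of communication -/

/-- Reduction of a single thread in which communication is made local: besides the intuitionistic
steps, any output channel may become the input channel of the same name and type, and `get b S v`
may become `⟨v, w₁, …, wₚ⟩` for any list of messages with `M b S [w₁, …, wₚ]`. -/
inductive Red (M : ℕ → Ty → List Tm → Prop) : Tm → Tm → Prop
  | beta (A : Ty) (u t : Tm) : Red M (.app (.lam A u) t) (u.subst0 t)
  | fst (u v : Tm) : Red M (.proj false (.pair u v)) u
  | snd (u v : Tm) : Red M (.proj true (.pair u v)) v
  | turn (b : ℕ) (S : Ty) : Red M (.send b S) (.get b S)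
  | recv {b : ℕ} {S : Ty} {ws : List Tm} (v : Tm) :
      M b S ws → Red M (.app (.get b S) v) (Tm.tuple v ws)
  | lam (A : Ty) {u u' : Tm} : Red M u u' → Red M (.lam A u) (.lam A u')
  | appL {t t' : Tm} (u : Tm) : Red M t t' → Red M (.app t u) (.app t' u)
  | appR (t : Tm) {u u' : Tm} : Red M u u' → Red M (.app t u) (.app t u')
  | pairL {t t' : Tm} (u : Tm) : Red M t t' → Red M (.pair t u) (.pair t' u)
  | pairR (t : Tm) {u u' : Tm} : Red M u u' → Red M (.pair t u) (.pair t u')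
  | proj (b : Bool) {u u' : Tm} : Red M u u' → Red M (.proj b u) (.proj b u')
  | efq (P : ℕ) {u u' : Tm} : Red M u u' → Red M (.efq P u) (.efq P u')

/-- All messages are invariant under substitution, that is, closed. -/
def ClosedMsgs (M : ℕ → Ty → List Tm → Prop) : Prop :=
  ∀ b S ws, M b S ws → ∀ w ∈ ws, ∀ σ, Tm.subst σ w = w

/-- Strong normalizability of a thread for `Red M`. -/
def TSN (M : ℕ → Ty → List Tm → Prop) (t : Tm) : Prop :=
  Acc (fun t' t => Red M t t') t

variable {M : ℕ → Ty → List Tm → Prop}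

theorem TStep.red {t t' : Tm} (h : TStep t t') : Red M t t' := by
  cases h with
  | ctx C hs =>
    induction C with
    | hole =>
      cases hs with
      | beta => exact .beta _ _ _
      | fst => exact .fst _ _
      | snd => exact .snd _ _
    | lam A C ih => exact .lam A ih
    | appL C u ih => exact .appL u ih
    | appR t C ih => exact .appR t ih
    | pairL C u ih => exact .pairL u ih
    | pairR t C ih => exact .pairR t ih
    | proj b C ih => exact .proj b ih
    | efq P C ih => exact .efq P ih

theorem Red.fill_subst (C : Ctx) {s s' : Tm} {σ : ℕ → Tm}
    (h : Red M (s.subst (Tm.upSub^[C.depth] σ)) (s'.subst (Tm.upSub^[C.depth] σ))) :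
    Red M ((C.fill s).subst σ) ((C.fill s').subst σ) := by
  induction C generalizing σ with
  | hole => exact h
  | lam A C ih => exact .lam A (ih h)
  | appL C u ih => exact .appL _ (ih h)
  | appR t C ih => exact .appR _ (ih h)
  | pairL C u ih => exact .pairL _ (ih h)
  | pairR t C ih => exact .pairR _ (ih h)
  | proj b C ih => exact .proj b (ih h)
  | efq P C ih => exact .efq P (ih h)

theorem Red.subst (hM : ClosedMsgs M) {t t' : Tm} (h : Red M t t') (σ : ℕ → Tm) :
    Red M (t.subst σ) (t'.subst σ) := by
  induction h generalizing σ with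
  | beta A u t => rw [Tm.subst_subst0]; exact .beta A _ _
  | fst u v => exact .fst _ _
  | snd u v => exact .snd _ _
  | turn b S => exact .turn b S
  | recv v hw =>
    rw [Tm.subst_tuple, List.map_congr_left fun w h => hM _ _ _ hw w h σ, List.map_id']
    exact .recv _ hw
  | lam A _ ih => exact .lam A (ih _)
  | appL u _ ih => exact .appL _ (ih σ)
  | appR t _ ih => exact .appR _ (ih σ)
  | pairL u _ ih => exact .pairL _ (ih σ)
  | pairR t _ ih => exact .pairR _ (ih σ)
  | proj b _ ih => exact .proj b (ih σ)
  | efq P _ ih => exact .efq P (ih σ)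

/-- If `F` maps steps to steps, then `t` is strongly normalizable when `F t` is. -/
theorem TSN.of_map (F : Tm → Tm) (hF : ∀ t t', Red M t t' → Red M (F t) (F t')) {t : Tm}
    (h : TSN M (F t)) : TSN M t :=
  Subrelation.accessible (fun h => hF _ _ h) (InvImage.accessible F h)

/-! ### Reducibility -/

/-- Tait's reducibility predicates. They are predicates on all raw terms. -/
def Reducible (M : ℕ → Ty → List Tm → Prop) : Ty → Tm → Prop
  | .bot, t => TSN M t
  | .atom _, t => TSN M t
  | .arr A B, t => ∀ u, Reducible M A u → Reducible M B (.app t u)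
  | .and A B, t => Reducible M A (.proj false t) ∧ Reducible M B (.proj true t)

/-- The terms that do not form a redex when they are applied or projected. An input channel is
among them only if it has no messages to receive. -/
def Neutral (M : ℕ → Ty → List Tm → Prop) : Tm → Prop
  | .lam _ _ => False
  | .pair _ _ => False
  | .get b S => ∀ ws, ¬ M b S ws
  | _ => True

theorem reducible_properties (A : Ty) :
    (∀ t, Reducible M A t → TSN M t) ∧
    (∀ t t', Reducible M A t → Red M t t' → Reducible M A t') ∧
    (∀ t, Neutral M t → (∀ t', Red M t t' → Reducible M A t') → Reducible M A t) := by
  induction A with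
  | bot => exact ⟨fun _ h => h, fun _ _ h hr => h.inv hr, fun _ _ h => ⟨_, h⟩⟩
  | atom P => exact ⟨fun _ h => h, fun _ _ h hr => h.inv hr, fun _ _ h => ⟨_, h⟩⟩
  | arr A B ihA ihB =>
    obtain ⟨a₁, a₂, a₃⟩ := ihA
    obtain ⟨b₁, b₂, b₃⟩ := ihB
    refine ⟨fun t h => ?_, fun t t' h hr u hu => b₂ _ _ (h u hu) (.appL u hr), ?_⟩
    · have h0 : Reducible M A (.var 0) := a₃ _ trivial fun t' h => nomatch h
      exact TSN.of_map (fun t => .app t (.var 0)) (fun _ _ h => .appL _ h) (b₁ _ (h _ h0))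
    · intro t hn h u hu
      have hu' := a₁ u hu
      induction hu' with
      | intro u _ ih =>
        refine b₃ _ trivial fun s hs => ?_
        cases hs with
        | beta => exact hn.elim
        | recv _ hw => exact absurd hw (hn _)
        | appL _ hr => exact h _ hr _ hu
        | appR _ hr => exact ih _ hr (a₂ _ _ hu hr)
  | and A B ihA ihB =>
    obtain ⟨a₁, a₂, a₃⟩ := ihA
    obtain ⟨b₁, b₂, b₃⟩ := ihB
    refine ⟨fun t h => ?_, fun t t' h hr => ?_, fun t hn h => ⟨?_, ?_⟩⟩
    · exact TSN.of_map (.proj false) (fun _ _ h => .proj _ h) (a₁ _ h.1)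
    · exact ⟨a₂ _ _ h.1 (.proj _ hr), b₂ _ _ h.2 (.proj _ hr)⟩
    · refine a₃ _ trivial fun s hs => ?_
      cases hs with
      | fst => exact hn.elim
      | proj _ hr => exact (h _ hr).1
    · refine b₃ _ trivial fun s hs => ?_
      cases hs with
      | snd => exact hn.elim
      | proj _ hr => exact (h _ hr).2

namespace Reducible

theorem tsn {A : Ty} {t : Tm} (h : Reducible M A t) : TSN M t :=
  (reducible_properties A).1 t h

theorem red {A : Ty} {t t' : Tm} (h : Reducible M A t) (hr : Red M t t') : Reducible M A t' :=
  (reducible_properties A).2.1 t t' h hr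

theorem of_neutral {A : Ty} {t : Tm} (hn : Neutral M t)
    (h : ∀ t', Red M t t' → Reducible M A t') : Reducible M A t :=
  (reducible_properties A).2.2 t hn h

theorem var (A : Ty) (n : ℕ) : Reducible M A (.var n) :=
  of_neutral trivial fun _ h => nomatch h

theorem pair {A B : Ty} {u v : Tm} (hu : Reducible M A u) (hv : Reducible M B v) :
    Reducible M (.and A B) (.pair u v) := by
  have hu' := hu.tsn
  induction hu' generalizing v with
  | intro u _ ihu =>
    have hv' := hv.tsn
    induction hv' with
    | intro v _ ihv =>
      constructor <;> refine of_neutral trivial fun s hs => ?_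
      · cases hs with
        | fst => exact hu
        | proj _ hr =>
          cases hr with
          | pairL _ hr => exact (ihu _ hr (hu.red hr) hv).1
          | pairR _ hr => exact (ihv _ hr (hv.red hr)).1
      · cases hs with
        | snd => exact hv
        | proj _ hr =>
          cases hr with
          | pairL _ hr => exact (ihu _ hr (hu.red hr) hv).2
          | pairR _ hr => exact (ihv _ hr (hv.red hr)).2

theorem tuple {v : Tm} {X : Ty} {ws : List Tm} {Ys : List Ty}
    (hv : Reducible M X v) (hws : List.Forall₂ (fun w Y => Reducible M Y w) ws Ys)
    (hne : Ys ≠ []) : Reducible M (.and X (Schema.conj Ys)) (Tm.tuple v ws) := by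
  induction hws generalizing v X with
  | nil => exact absurd rfl hne
  | @cons w Y ws Ys hw hws ih =>
    refine .pair hv ?_
    cases Ys with
    | nil => cases hws; exact hw
    | cons Z Ys => exact ih hw (by simp)

theorem lam (hM : ClosedMsgs M) {A B : Ty} {u : Tm}
    (h : ∀ v, Reducible M A v → Reducible M B (u.subst0 v)) :
    Reducible M (.arr A B) (.lam A u) := by
  intro v hv
  have hu : TSN M u := by
    have := (h _ (var A 0)).tsn
    rw [Tm.subst0_eq] at this
    exact this.of_map _ fun _ _ h => h.subst hM _
  induction hu generalizing v with
  | intro u _ ihu =>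
    have hv' := hv.tsn
    induction hv' with
    | intro v _ ihv =>
      refine of_neutral trivial fun s hs => ?_
      cases hs with
      | beta => exact h v hv
      | appL _ hr =>
        cases hr with
        | lam _ hr =>
          refine ihu _ hr (fun x hx => (h x hx).red ?_) v hv
          rw [Tm.subst0_eq, Tm.subst0_eq]
          exact hr.subst hM _
      | appR _ hr => exact ihv _ hr (hv.red hr)

theorem send {b : ℕ} {S A : Ty} (h : Reducible M A (.get b S)) : Reducible M A (.send b S) :=
  of_neutral trivial fun _ hs => by cases hs; exact h

/-- A channel without messages to receive is reducible, like a variable. -/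
theorem get_of_idle {b : ℕ} {S A : Ty} (h : ∀ ws, ¬ M b S ws) : Reducible M A (.get b S) :=
  of_neutral h fun _ hs => nomatch hs

/-- An input channel is reducible if all messages that it can receive are. -/
theorem get {b : ℕ} {X : Ty} {Ys : List Ty} (hne : Ys ≠ [])
    (h : ∀ ws, M b (.arr X (.and X (Schema.conj Ys))) ws →
      List.Forall₂ (fun w Y => Reducible M Y w) ws Ys) :
    Reducible M (.arr X (.and X (Schema.conj Ys))) (.get b (.arr X (.and X (Schema.conj Ys)))) := by
  intro v hv
  have hv' := hv.tsn
  induction hv' with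
  | intro v _ ih =>
    refine of_neutral trivial fun s hs => ?_
    cases hs with
    | recv _ hw => exact hv.tuple (h _ hw) hne
    | appL _ hr => cases hr
    | appR _ hr => exact ih _ hr (hv.red hr)

end Reducible

/-- The fundamental lemma: a typed thread whose input channels are reducible is reducible under
every reducible substitution. -/
theorem HasType.reducible (hM : ClosedMsgs M) {Γ : List Ty} {t : Tm} {A : Ty}
    (ht : HasType Γ t A) (hc : t.AllChan fun b S => Reducible M S (.get b S)) {σ : ℕ → Tm}
    (hσ : ∀ n B, Γ[n]? = some B → Reducible M B (σ n)) : Reducible M A (t.subst σ) := by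
  induction ht generalizing σ with
  | var h => exact hσ _ _ h
  | send a T => exact Reducible.send hc
  | get a T => exact hc
  | lam _ ih =>
    refine Reducible.lam hM fun v hv => ?_
    rw [Tm.subst0_subst_upSub]
    refine ih hc ?_
    rintro (_ | n) B hB
    · cases hB; exact hv
    · exact hσ n B hB
  | app _ _ ih₁ ih₂ => exact ih₁ hc.1 hσ _ (ih₂ hc.2 hσ)
  | pair _ _ ih₁ ih₂ => exact (ih₁ hc.1 hσ).pair (ih₂ hc.2 hσ)
  | fst _ ih => exact (ih hc hσ).1
  | snd _ ih => exact (ih hc hσ).2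
  | @efq Γ P u _ ih =>
    have h : TSN M (u.subst σ) := ih hc hσ
    change TSN M (.efq P (u.subst σ))
    generalize u.subst σ = u at h
    induction h with
    | intro u _ ih =>
      refine ⟨_, fun s hs => ?_⟩
      cases hs with
      | efq _ hr => exact ih _ hr

/-! ### Threads of a process -/

/-- The messages for a process whose channel `a` has type `X → X ∧ (Y₁ ∧ … ∧ Yₚ)`: lists of closed
threads of types `Y₁, …, Yₚ` in which `a` does not occur. -/
def Msgs (a : ℕ) (X : Ty) (Ys : List Ty) (b : ℕ) (S : Ty) (ws : List Tm) : Prop :=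
  b = a ∧ S = .arr X (.and X (Schema.conj Ys)) ∧ Ys ≠ [] ∧
    List.Forall₂ (fun w Y => HasType [] w Y ∧ ¬ Tm.Occurs a w) ws Ys

/-- A substitution that replaces every variable declared in `Γ` by a channel other than `a`. -/
def closing (a : ℕ) (Γ : List Ty) (n : ℕ) : Tm := .get (a + 1) (Γ[n]?.getD .bot)

theorem exists_of_forall₂_of_mem_left {α β : Type*} {R : α → β → Prop} {l : List α} {l' : List β}
    (h : List.Forall₂ R l l') {x : α} (hx : x ∈ l) : ∃ y, R x y := by
  induction h with
  | nil => simp at hx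
  | cons h _ ih =>
    rcases List.mem_cons.1 hx with rfl | hx
    · exact ⟨_, h⟩
    · exact ih hx

theorem exists_mem_of_forall₂_of_mem_right {α β : Type*} {R : α → β → Prop} {l : List α}
    {l' : List β} (h : List.Forall₂ R l l') {y : β} (hy : y ∈ l') : ∃ x ∈ l, R x y := by
  induction h with
  | nil => simp at hy
  | cons h _ ih =>
    rcases List.mem_cons.1 hy with rfl | hy
    · exact ⟨_, List.mem_cons_self, h⟩
    · obtain ⟨x, hx, hR⟩ := ih hy
      exact ⟨x, List.mem_cons_of_mem _ hx, hR⟩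

theorem closedMsgs_msgs (a : ℕ) (X : Ty) (Ys : List Ty) : ClosedMsgs (Msgs a X Ys) := by
  rintro b S ws ⟨-, -, -, h⟩ w hw σ
  obtain ⟨Y, hY⟩ := exists_of_forall₂_of_mem_left h hw
  exact hY.1.subst_of_closed σ

theorem HasType.closing {Γ : List Ty} {t : Tm} {A : Ty} (h : HasType Γ t A) (a : ℕ) :
    HasType [] (t.subst (closing a Γ)) A :=
  h.subst fun n B hB => by simpa [LamPar.closing, hB] using HasType.get (a + 1) B

theorem not_occurs_closing {a : ℕ} (Γ : List Ty) {t : Tm} (h : ¬ Tm.Occurs a t) :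
    ¬ Tm.Occurs a (t.subst (closing a Γ)) := by
  rw [Tm.not_occurs_iff] at h ⊢
  refine Tm.AllChan.subst (fun n => ?_) h
  exact Nat.succ_ne_self a

/-- The messages do not contain `a`, and are therefore reducible independently of the reducibility
of the channel `a`, which in turn follows from that of the messages. -/
theorem reducible_get_msgs (a : ℕ) (X : Ty) (Ys : List Ty) :
    Reducible (Msgs a X Ys) (.arr X (.and X (Schema.conj Ys)))
      (.get a (.arr X (.and X (Schema.conj Ys)))) := by
  by_cases hne : Ys = []
  · exact Reducible.get_of_idle fun ws h => h.2.2.1 hne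
  · refine Reducible.get hne fun ws h => h.2.2.2.imp fun w Y hw => ?_
    rw [← hw.1.subst_of_closed Tm.var]
    refine hw.1.reducible (closedMsgs_msgs a X Ys) ?_ fun n B _ => Reducible.var B n
    exact ((Tm.not_occurs_iff a w).1 hw.2).mono fun b S hb =>
      Reducible.get_of_idle fun ws h => hb h.1

theorem HasType.tsn_closing {Γ : List Ty} {t : Tm} {A : Ty} (h : HasType Γ t A) {a : ℕ} {X : Ty}
    {Ys : List Ty} (ho : t.OccursOnlyAt a (.arr X (.and X (Schema.conj Ys)))) :
    TSN (Msgs a X Ys) (t.subst (LamPar.closing a Γ)) := by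
  refine (h.reducible (closedMsgs_msgs a X Ys) ?_ fun n B _ => ?_).tsn
  · refine ((Tm.occursOnlyAt_iff _ _ _).1 ho).mono fun b S hS => ?_
    by_cases hb : b = a
    · cases hb
      cases hS rfl
      exact reducible_get_msgs a X Ys
    · exact Reducible.get_of_idle fun ws h => hb h.1
  · exact Reducible.get_of_idle fun ws h => Nat.succ_ne_self a h.1

/-- Strong normalization of the threads for intuitionistic steps alone. -/
theorem HasType.tsn_of_no_msgs {Γ : List Ty} {t : Tm} {A : Ty} (h : HasType Γ t A) :
    TSN (fun _ _ _ => False) t := by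
  have := (h.reducible (M := fun _ _ _ => False) (fun _ _ _ h => h.elim)
    (Tm.AllChan.mono (P := fun _ _ => True) (fun b S _ => Reducible.get_of_idle fun ws h => h)
      ?_) fun n B _ => Reducible.var B n).tsn
  · rwa [Tm.subst_var] at this
  · clear h
    induction t <;> simp_all [Tm.AllChan]

/-- A thread is typed, with the channel `a` at type `T`. -/
def ThreadTyped (Γ : List Ty) (a : ℕ) (T B : Ty) (t : Tm) : Prop :=
  HasType Γ t B ∧ t.OccursOnlyAt a T

theorem ThreadTyped.tstep {Γ : List Ty} {a : ℕ} {T B : Ty} {t t' : Tm}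
    (h : ThreadTyped Γ a T B t) (ht : TStep t t') : ThreadTyped Γ a T B t' :=
  ⟨h.1.tstep ht, (Tm.occursOnlyAt_iff _ _ _).2 (((Tm.occursOnlyAt_iff _ _ _).1 h.2).tstep ht)⟩

theorem ThreadTyped.lstep {Γ : List Ty} {a : ℕ} {T B : Ty} {l l' : List Tm}
    (h : ∀ t ∈ l, ThreadTyped Γ a T B t) (hl : LStep l l') :
    ∀ t ∈ l', ThreadTyped Γ a T B t := by
  cases hl with
  | mk l r ht =>
    simp only [List.forall_mem_append, List.forall_mem_cons] at h ⊢
    exact ⟨h.1, h.2.1.tstep ht, h.2.2⟩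

/-- The process that sends stays typed, and the message has the type of the argument of the
channel. -/
theorem ThreadTyped.sends {Γ : List Ty} {a : ℕ} {X Y B : Ty} {l l' : List Tm} {w : Tm}
    (h : ∀ t ∈ l, ThreadTyped Γ a (.arr X Y) B t) (hs : Sends a l w l') :
    HasType Γ w X ∧ ¬ Tm.Occurs a w ∧ ∀ t ∈ l', ThreadTyped Γ a (.arr X Y) B t := by
  cases hs with
  | mk l r C T w _ _ hw =>
    simp only [List.forall_mem_append, List.forall_mem_cons] at h ⊢
    obtain ⟨hl, ⟨ht, ho⟩, hr⟩ := h
    rw [Tm.occursOnlyAt_iff] at ho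
    obtain ⟨hc, hc'⟩ := C.allChan_fill ho
    cases hc.1 rfl
    obtain ⟨Δ, Z, hd, hZ, hf⟩ := ht.fill
    cases hZ with
    | app h₁ h₂ =>
      cases h₁
      refine ⟨HasType.lift_iff.1 (hd ▸ h₂), hw, hl, ⟨hf _ (.app (.get _ _) h₂), ?_⟩, hr⟩
      exact (Tm.occursOnlyAt_iff _ _ _).2 (hc' _ hc)

theorem ThreadTyped.receives {Γ : List Ty} {a : ℕ} {X B : Ty} {Ys : List Ty} {ws : List Tm}
    {t t' : Tm} (h : ThreadTyped Γ a (.arr X (.and X (Schema.conj Ys))) B t)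
    (hr : Receives a ws t t') (hne : Ys ≠ [])
    (hw : List.Forall₂ (fun w Y => HasType Γ w Y ∧ ¬ Tm.Occurs a w) ws Ys) :
    ThreadTyped Γ a (.arr X (.and X (Schema.conj Ys))) B t' := by
  cases hr with
  | idle _ _ => exact h
  | recv D T v _ _ =>
    obtain ⟨ht, ho⟩ := h
    rw [Tm.occursOnlyAt_iff] at ho
    obtain ⟨hc, hc'⟩ := D.allChan_fill ho
    cases hc.1 rfl
    obtain ⟨Δ, Z, hd, hZ, hf⟩ := ht.fill
    cases hZ with
    | app h₁ h₂ =>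
      cases h₁
      refine ⟨hf _ (h₂.tuple ?_ hne), (Tm.occursOnlyAt_iff _ _ _).2 (hc' _ ?_)⟩
      · rw [List.forall₂_map_left_iff]
        exact hw.imp fun w Y h => hd ▸ HasType.lift_iff.2 h.1
      · refine Tm.allChan_tuple hc.2 fun w' hw' => ?_
        obtain ⟨w, hmem, rfl⟩ := List.mem_map.1 hw'
        obtain ⟨Y, hY⟩ := exists_of_forall₂_of_mem_left hw hmem
        exact (Tm.allChan_rename _ _).2
          (((Tm.not_occurs_iff a w).1 hY.2).mono fun b S hb h => absurd h hb)

/-- The turning of an output channel by a communication is a local step of the sending thread. -/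
theorem red_turn_subst {a : ℕ} {T : Ty} (C : Ctx) (s : Tm) (σ : ℕ → Tm) :
    Red M ((C.fill (.app (.send a T) s)).subst σ) ((C.fill (.app (.get a T) s)).subst σ) :=
  Red.fill_subst C (.appL _ (.turn a T))

/-- Receiving is a local step once the free variables have been replaced by channels: the messages
are then closed, so that lifting them does not change them. -/
theorem Receives.red {Γ : List Ty} {a : ℕ} {X B : Ty} {Ys : List Ty} {ws : List Tm}
    {t t' : Tm} (h : ThreadTyped Γ a (.arr X (.and X (Schema.conj Ys))) B t)
    (hr : Receives a ws t t') (hne : Ys ≠ [])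
    (hw : List.Forall₂ (fun w Y => HasType Γ w Y ∧ ¬ Tm.Occurs a w) ws Ys)
    (ho : Tm.Occurs a t) :
    Red (Msgs a X Ys) (t.subst (closing a Γ)) (t'.subst (closing a Γ)) := by
  cases hr with
  | idle _ hn => exact absurd ho hn
  | recv D T v _ _ =>
    have hT := (D.allChan_fill ((Tm.occursOnlyAt_iff _ _ _).1 h.2)).1.1 rfl
    refine Red.fill_subst D ?_
    rw [Tm.subst_tuple, List.map_map]
    refine .recv _ ⟨rfl, hT, hne, ?_⟩
    rw [List.forall₂_map_left_iff]
    refine hw.imp fun w Y hwY => ?_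
    have hc := hwY.1.closing a
    simp only [Function.comp_apply, Tm.subst_iterate_upSub_lift, hc.lift_of_closed]
    exact ⟨hc, not_occurs_closing Γ hwY.2⟩

/-! ### The termination measure -/

/-- Finite formal sums of ordinals, the largest ordinals being compared first. This order is
well-founded, and addition is strictly monotone in both arguments. -/
abbrev OrdSum : Type 1 := Colex (Ordinal.{0} →₀ ℕ)

open scoped Classical in
/-- The ordinal rank of a thread for the converse of `Red M`, as a formal sum with one term; the
value is `0` for threads that are not strongly normalizable. -/
noncomputable def rk (M : ℕ → Ty → List Tm → Prop) (t : Tm) : OrdSum :=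
  if h : Acc (fun t' t => Red M t t') t then toColex (Finsupp.single h.rank 1) else 0

theorem rk_lt {t t' : Tm} (h : TSN M t) (hr : Red M t t') : rk M t' < rk M t := by
  have h' : TSN M t' := h.inv hr
  unfold TSN at h h'
  simp only [rk, h, h', dif_pos]
  exact Finsupp.Colex.single_strictMono (Acc.rank_lt_of_rel h hr)

/-- The formal sum of the ranks of the threads of a process, after a substitution. -/
noncomputable def lrk (M : ℕ → Ty → List Tm → Prop) (σ : ℕ → Tm) (l : List Tm) : OrdSum :=
  (l.map fun t => rk M (t.subst σ)).sum

theorem lrk_lt_of_red {σ : ℕ → Tm} {l r : List Tm} {t t' : Tm} (h : TSN M (t.subst σ))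
    (hr : Red M (t.subst σ) (t'.subst σ)) : lrk M σ (l ++ t' :: r) < lrk M σ (l ++ t :: r) := by
  simp only [lrk, List.map_append, List.map_cons, List.sum_append, List.sum_cons]
  gcongr
  exact rk_lt h hr

theorem LStep.lrk_lt (hM : ClosedMsgs M) {σ : ℕ → Tm} {l l' : List Tm} (hl : LStep l l')
    (h : ∀ t ∈ l, TSN M (t.subst σ)) : lrk M σ l' < lrk M σ l := by
  cases hl with
  | mk l r ht => exact lrk_lt_of_red (h _ (by simp)) (ht.red.subst hM σ)

theorem lrk_receives {σ : ℕ → Tm} {a : ℕ} {ws l l' : List Tm}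
    (h : ∀ t ∈ l, TSN M (t.subst σ))
    (hr : ∀ t ∈ l, ∀ t', Receives a ws t t' → Tm.Occurs a t → Red M (t.subst σ) (t'.subst σ))
    (hl : List.Forall₂ (Receives a ws) l l') :
    lrk M σ l' ≤ lrk M σ l ∧ ((∃ t ∈ l, Tm.Occurs a t) → lrk M σ l' < lrk M σ l) := by
  induction hl with
  | nil => simp
  | @cons t t' l l' ht _ ih =>
    simp only [List.forall_mem_cons] at h hr
    obtain ⟨ih₁, ih₂⟩ := ih h.2 hr.2
    simp only [lrk, List.map_cons, List.sum_cons] at ih₁ ih₂ ⊢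
    by_cases ho : Tm.Occurs a t
    · have hlt := add_lt_add_of_lt_of_le (rk_lt h.1 (hr.1 _ ht ho)) ih₁
      exact ⟨hlt.le, fun _ => hlt⟩
    · have : t' = t := by
        cases ht with
        | idle => rfl
        | recv D T v _ _ =>
          refine absurd ((Tm.not_occurs_iff _ _).1 ho) fun h => ?_
          exact (D.allChan_fill h).1.1 rfl
      subst this
      refine ⟨by gcongr, ?_⟩
      rintro ⟨s, hs, hso⟩
      have hs : s ∈ l := (List.mem_cons.1 hs).resolve_left fun h => ho (h ▸ hso)
      have := ih₂ ⟨s, hs, hso⟩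
      gcongr

/-! ### Strong normalization -/

theorem acc_par {Γ : List Ty} {B : Ty} (l : List Tm) (h : ∀ t ∈ l, HasType Γ t B) :
    Acc (fun t' t => Step t t') (.par l) := by
  induction hn : lrk (fun _ _ _ => False) Tm.var l using WellFoundedLT.induction
    generalizing l with
  | ind n ih =>
    subst hn
    refine ⟨_, fun s hs => ?_⟩
    cases hs with
    | @par _ l' hl =>
      refine ih _ (hl.lrk_lt (fun _ _ _ h => h.elim) fun t ht => ?_) l' ?_ rfl
      · rw [Tm.subst_var]
        exact (h t ht).tsn_of_no_msgs
      · cases hl with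
        | mk l r ht =>
          simp only [List.forall_mem_append, List.forall_mem_cons] at h ⊢
          exact ⟨h.1, h.2.1.tstep ht, h.2.2⟩

section Chan

variable {Γ : List Ty} {a : ℕ} {S : Schema} {B : Ty}

/-- All threads of the processes are typed, for the instance of the schema given by `A`. -/
def ProcTyped (Γ : List Ty) (a : ℕ) (S : Schema) (B : Ty) (A : Fin S.size → Ty)
    (u : Fin S.size → List Tm) : Prop :=
  ∀ i, ∀ t ∈ u i, ThreadTyped Γ a (S.chanTy A i) B t

/-- The rank of the `i`-th process, for the messages that it can receive. -/
noncomputable def procRk (Γ : List Ty) (a : ℕ) (S : Schema) (A : Fin S.size → Ty)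
    (i : Fin S.size) (l : List Tm) : OrdSum :=
  lrk (Msgs a (A i) ((S.links i).map A)) (closing a Γ) l

variable {A : Fin S.size → Ty} {u u' : Fin S.size → List Tm}

theorem procRk_lt_of_sends {i : Fin S.size} {l l' : List Tm} {w : Tm}
    (h : ∀ t ∈ l, ThreadTyped Γ a (S.chanTy A i) B t) (hs : Sends a l w l') :
    procRk Γ a S A i l' < procRk Γ a S A i l := by
  cases hs with
  | mk l r C T w _ _ _ =>
    have ht := h (C.fill (.app (.send a T) (w.lift C.depth))) (by simp)
    exact lrk_lt_of_red (ht.1.tsn_closing ht.2) (red_turn_subst C _ _)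

/-- A communication preserves types and decreases the sum of the ranks. -/
theorem ProcTyped.comm (h : ProcTyped Γ a S B A u) (hc : Comm a S u u') :
    ProcTyped Γ a S B A u' ∧
      ∑ i, procRk Γ a S A i (u' i) < ∑ i, procRk Γ a S A i (u i) := by
  obtain ⟨j, w, hne, hj, hex, hsend, hrecv, hid⟩ := hc
  have hne' : (S.links j).map A ≠ [] := by simpa using hne
  have hw : List.Forall₂ (fun w Y => HasType Γ w Y ∧ ¬ Tm.Occurs a w)
      ((S.links j).map w) ((S.links j).map A) := by
    rw [List.forall₂_map_left_iff, List.forall₂_map_right_iff, List.forall₂_same]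
    intro i hi
    have := ThreadTyped.sends (h i) (hsend i ⟨fun e => hj (e ▸ hi), hi⟩)
    exact ⟨this.1, this.2.1⟩
  have hrk := lrk_receives (fun t ht => (h j t ht).1.tsn_closing (h j t ht).2)
    (fun t ht t' hr => hr.red (h j t ht) hne' hw) hrecv
  refine ⟨fun i => ?_, Finset.sum_lt_sum (fun i _ => ?_) ⟨j, Finset.mem_univ j, hrk.2 hex⟩⟩
  · by_cases hi : S.Outlinked i j
    · exact (ThreadTyped.sends (h i) (hsend i hi)).2.2
    · by_cases hij : i = j
      · subst hij
        intro t' ht'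
        obtain ⟨t, ht, hr⟩ := exists_mem_of_forall₂_of_mem_right hrecv ht'
        exact (h i t ht).receives hr hne' hw
      · rw [hid i hi hij]
        exact h i
  · by_cases hi : S.Outlinked i j
    · exact (procRk_lt_of_sends (h i) (hsend i hi)).le
    · by_cases hij : i = j
      · subst hij
        exact hrk.1
      · rw [hid i hi hij]

theorem acc_chan (u : Fin S.size → List Tm) (h : ProcTyped Γ a S B A u) :
    Acc (fun t' t => Step t t') (.chan a S u) := by
  induction hn : ∑ i, procRk Γ a S A i (u i) using WellFoundedLT.induction generalizing u with
  | ind n ih =>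
    subst hn
    refine ⟨_, fun s hs => ?_⟩
    cases hs with
    | @thread _ _ _ i l hl =>
      refine ih _ ?_ (Function.update u i l) (fun k => ?_) rfl
      · have hlt : procRk Γ a S A i l < procRk Γ a S A i (u i) :=
          hl.lrk_lt (closedMsgs_msgs _ _ _) fun t ht => (h i t ht).1.tsn_closing (h i t ht).2
        refine Finset.sum_lt_sum (fun k _ => ?_) ⟨i, Finset.mem_univ i, by simpa using hlt⟩
        by_cases hk : k = i
        · subst hk
          simpa using hlt.le
        · simp [hk]
      · by_cases hk : k = i
        · subst hk
          simpa using ThreadTyped.lstep (h k) hl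
        · simpa [hk] using h k
    | comm hc => exact ih _ (h.comm hc).2 _ (h.comm hc).1 rfl
    | simplify _ hl _ =>
      refine acc_par (Γ := Γ) (B := B) _ fun t ht => ?_
      obtain ⟨l, hl', htl⟩ := List.mem_flatten.1 (hl.subset ht)
      obtain ⟨i, rfl⟩ := List.mem_ofFn.1 hl'
      exact (h i t htl).1

end Chan

end LamPar

theorem theorem2 (Γ : List LamPar.Ty) (t : LamPar.PTm) (A : LamPar.Ty)
    (ht : LamPar.PHasType Γ t A) : LamPar.SN t := by
  have hacc : Acc (fun t' t => LamPar.Step t t') t := by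
    cases ht with
    | par _ h => exact LamPar.acc_par _ h
    | chan A _ h => exact LamPar.acc_chan _ h
  rintro ⟨f, rfl, hf⟩
  exact not_acc_iff_exists_descending_chain.2 ⟨f, rfl, hf⟩ hacc
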